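/- Throughout, Banach spaces are real or complex. Let $A$ be a convex bounded subset of a Banach space $X$. A *slice* of $A$ is a set $S(A,x^*,\varepsilon)=\{x\in A:\operatorname{Re}x^*(x)>\sup \operatorname{Re}x^*(A)-\varepsilon\}$ with $x^*\in X^*$ and $\varepsilon>0$. The set $A$ is *slicely countably determined* (SCD) if there is a sequence $(S_n)_{n\in\mathbb N}$ of slices of $A$ such that $A\subseteq\overline{\operatorname{conv}}(B)$ for every $B\subseteq A$ that intersects all the $S_n$. A separable Banach space $X$ is an *SCD space* if every convex bounded subset of $X$ is an SCD set. Let $E$ be a Banach space of scalar sequences which contains the canonical vectors $e_n=(\delta_{nk})_{k\in\mathbb N}$, $n\in\mathbb N$, and which satisfies: for every $(t_i)\in E$, $(|t_i|)\in E$ and $\|(t_i)\|_E=\|(|t_i|)\|_E$. Assume that $(e_n)$ is a $1$-unconditional Schauder basis of $E$ (that is, a Schauder basis with $\|\sum_{n\in F}\theta_na_ne_n\|_E\le\|\sum_{n\in F}a_ne_n\|_E$ for all finite $F\subseteq\mathbb N$ and all scalars $a_n,\theta_n$ with $|\theta_n|=1$) and that it is shrinking (that is, for every $f\in E^*$ the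 norm of the restriction of $f$ to the closed linear span of $\{e_k:k\ge n\}$ tends to $0$ as $n\to\infty$). For a sequence $(X_n)_{n\in\mathbb N}$ of Banach spaces over the same field, let $\left[\bigoplus_{n\in\mathbb N}X_n\right]_E$ be the space of all $(x_n)\in\prod_{n}X_n$ with $(\|x_n\|)_n\in E$, with coordinatewise operations and the norm $\|(x_n)\|=\|(\|x_n\|)_n\|_E$. **Theorem.** If every $X_n$ ($n\in\mathbb N$) is an SCD space, then $\left[\bigoplus_{n\in\mathbb N}X_n\right]_E$ is an SCD space (in particular, a separable Banach space). -/

import Mathlib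

open Filter Topology

noncomputable section

/-! ### Slicely countably determined sets and spaces -/

section SCD

variable (𝕜 : Type*) [RCLike 𝕜] {X : Type*} [NormedAddCommGroup X] [NormedSpace 𝕜 X]

/-- The slice `S(A, x*, ε) = {x ∈ A : Re x*(x) > sup Re x*(A) - ε}`. -/
def slice (A : Set X) (f : StrongDual 𝕜 X) (ε : ℝ) : Set X :=
  {x ∈ A | sSup ((fun a => RCLike.re (f a)) '' A) - ε < RCLike.re (f x)}

/-- A sequence `V` of subsets of `A` is determining for `A` if `A` is contained in the closed
convex hull of every `B ⊆ A` that meets all the `V n`. -/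
def IsDetermining {X : Type*} [NormedAddCommGroup X] [NormedSpace ℝ X]
    (A : Set X) (V : ℕ → Set X) : Prop :=
  (∀ n, V n ⊆ A) ∧
    ∀ B ⊆ A, (∀ n, (B ∩ V n).Nonempty) → A ⊆ closure (convexHull ℝ B)

/-- There is a determining sequence of slices of `A` (used for convex bounded sets `A`). -/
def IsSCDSet [NormedSpace ℝ X] (A : Set X) : Prop :=
  ∃ (f : ℕ → StrongDual 𝕜 X) (ε : ℕ → ℝ),
    (∀ n, 0 < ε n) ∧ IsDetermining A (fun n => slice 𝕜 A (f n) (ε n))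

variable (X) in
/-- A slicely countably determined space: a separable Banach space all of whose convex bounded
subsets are slicely countably determined. -/
structure IsSCDSpace [NormedSpace ℝ X] [IsScalarTower ℝ 𝕜 X] : Prop where
  complete : CompleteSpace X
  separable : TopologicalSpace.SeparableSpace X
  isSCDSet : ∀ A : Set X, Convex ℝ A → Bornology.IsBounded A → IsSCDSet 𝕜 A

end SCD

/-! ### Banach spaces of sequences -/

/-- The normed space `E` is a space of scalar sequences: `coord` identifies its elements with
sequences, the canonical vectors belong to `E`, and `‖(tᵢ)‖ = ‖(|tᵢ|)‖` for `(tᵢ) ∈ E`.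
(Completeness of `E` is a separate type class.) -/
structure SequenceSpace (𝕂 E : Type*) [RCLike 𝕂] [NormedAddCommGroup E] [NormedSpace 𝕂 E] where
  /-- The sequence that an element of `E` is. -/
  coord : E →ₗ[𝕂] (ℕ → 𝕂)
  coord_injective : Function.Injective coord
  /-- The canonical vectors. -/
  unit : ℕ → E
  coord_unit : ∀ n, coord (unit n) = Pi.single n 1
  exists_abs : ∀ t : E, ∃ s : E, (∀ n, coord s n = ((‖coord t n‖ : ℝ) : 𝕂)) ∧ ‖s‖ = ‖t‖

namespace SequenceSpace

variable {𝕂 E : Type*} [RCLike 𝕂] [NormedAddCommGroup E] [NormedSpace 𝕂 E]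

/-- The canonical vectors form a `1`-unconditional (Schauder) basis of `E`. -/
structure IsOneUnconditional (S : SequenceSpace 𝕂 E) : Prop where
  exists_basis : ∃ b : SchauderBasis 𝕂 E, b.basis = S.unit
  norm_le : ∀ (F : Finset ℕ) (a θ : ℕ → 𝕂), (∀ n, ‖θ n‖ = 1) →
    ‖∑ n ∈ F, (θ n * a n) • S.unit n‖ ≤ ‖∑ n ∈ F, a n • S.unit n‖

/-- The canonical vectors form a shrinking sequence: for every `f ∈ E*`, the norm of the
restriction of `f` to the closed linear span of `eₙ, eₙ₊₁, …` tends to `0`. -/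
def IsShrinking (S : SequenceSpace 𝕂 E) : Prop :=
  ∀ f : StrongDual 𝕂 E, Tendsto
    (fun n => ‖f.comp (Submodule.span 𝕂 (S.unit '' Set.Ici n)).topologicalClosure.subtypeL‖)
    atTop (𝓝 0)

variable (S : SequenceSpace 𝕂 E)

lemma norm_coord_smul_unit_le (x : E) (n : ℕ) : ‖S.coord x n • S.unit n‖ ≤ ‖x‖ := by
  obtain ⟨s, hs, hs'⟩ := S.exists_abs x
  obtain ⟨r, hr, hr'⟩ := S.exists_abs (x - (2 * S.coord x n) • S.unit n)
  have hrs : r = s := by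
    apply S.coord_injective
    funext m
    rw [hr, hs]
    congr 1
    rcases eq_or_ne m n with rfl | h
    · simp only [map_sub, map_smul, Pi.sub_apply, Pi.smul_apply, S.coord_unit, Pi.single_eq_same,
        smul_eq_mul, mul_one]
      rw [← norm_neg]
      congr 1
      ring
    · simp [S.coord_unit, Pi.single_eq_of_ne h]
  have h1 : ‖x - (2 * S.coord x n) • S.unit n‖ = ‖x‖ := by rw [← hr', ← hs', hrs]
  have h2 : (2 : ℝ) * ‖S.coord x n • S.unit n‖ = ‖(2 * S.coord x n) • S.unit n‖ := by
    rw [mul_smul, norm_smul (2 : 𝕂)]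
    simp
  have h3 : ‖(2 * S.coord x n) • S.unit n‖ ≤ ‖x‖ + ‖x - (2 * S.coord x n) • S.unit n‖ := by
    have := norm_sub_le x (x - (2 * S.coord x n) • S.unit n)
    simpa using this
  linarith

lemma unit_ne_zero (n : ℕ) : S.unit n ≠ 0 := by
  intro h
  have := congrFun (S.coord_unit n) n
  simp [h] at this

lemma continuous_coord (n : ℕ) : Continuous fun x : E => S.coord x n := by
  have hp : 0 < ‖S.unit n‖ := norm_pos_iff.2 (S.unit_ne_zero n)
  let f : E →ₗ[𝕂] 𝕂 := (LinearMap.proj n).comp S.coord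
  refine (f.mkContinuous (‖S.unit n‖⁻¹) fun x => ?_).continuous
  have := S.norm_coord_smul_unit_le x n
  rw [norm_smul] at this
  change ‖S.coord x n‖ ≤ _
  rw [inv_mul_eq_div, le_div_iff₀ hp]
  exact this

lemma coord_sum (F : Finset ℕ) (a : ℕ → 𝕂) (m : ℕ) :
    S.coord (∑ n ∈ F, a n • S.unit n) m = if m ∈ F then a m else 0 := by
  simp [map_sum, Finset.sum_apply, S.coord_unit, Pi.single_apply]

variable {S}

lemma coord_of_tendsto {a : ℕ → 𝕂} {x : E}
    (h : Tendsto (fun N => ∑ n ∈ Finset.range N, a n • S.unit n) atTop (𝓝 x)) (m : ℕ) :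
    S.coord x m = a m := by
  have h1 := ((S.continuous_coord m).tendsto x).comp h
  refine tendsto_nhds_unique h1 (tendsto_const_nhds.congr' ?_)
  filter_upwards [eventually_gt_atTop m] with N hN
  simp [coord_sum, hN]

lemma IsOneUnconditional.tendsto (hS : S.IsOneUnconditional) (x : E) :
    Tendsto (fun N => ∑ n ∈ Finset.range N, S.coord x n • S.unit n) atTop (𝓝 x) := by
  obtain ⟨b, hb⟩ := hS.exists_basis
  have h : Tendsto (fun N => ∑ n ∈ Finset.range N, b.coord n x • S.unit n) atTop (𝓝 x) := by
    simpa [hb] using b.tendsto_proj x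
  have h2 : (fun n => b.coord n x) = S.coord x := funext fun m => (coord_of_tendsto h m).symm
  simpa only [← h2] using h

lemma IsOneUnconditional.norm_sum_le (hS : S.IsOneUnconditional) (F : Finset ℕ) (a l : ℕ → 𝕂)
    (hl : ∀ n, ‖l n‖ ≤ 1) :
    ‖∑ n ∈ F, (l n * a n) • S.unit n‖ ≤ ‖∑ n ∈ F, a n • S.unit n‖ := by
  classical
  have key : ∀ (T : Finset ℕ) (l : ℕ → 𝕂), (∀ n, ‖l n‖ ≤ 1) → (∀ n, n ∉ T → ‖l n‖ = 1) →
      ‖∑ n ∈ F, (l n * a n) • S.unit n‖ ≤ ‖∑ n ∈ F, a n • S.unit n‖ := by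
    intro T
    induction T using Finset.induction_on with
    | empty => exact fun l _ h => hS.norm_le F a l fun n => h n (by simp)
    | insert m T hm ih =>
      intro l hl hT
      obtain ⟨u, hu, hlu⟩ : ∃ u : 𝕂, ‖u‖ = 1 ∧ l m = (‖l m‖ : 𝕂) * u := by
        rcases eq_or_ne (l m) 0 with h | h
        · exact ⟨1, by simp, by simp [h]⟩
        · have hn : (‖l m‖ : 𝕂) ≠ 0 := by simpa using h
          refine ⟨l m / (‖l m‖ : 𝕂), ?_, by field_simp⟩
          simp [h]
      have hv : ∀ v : 𝕂, ‖v‖ = 1 →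
          ‖∑ n ∈ F, (Function.update l m v n * a n) • S.unit n‖ ≤ ‖∑ n ∈ F, a n • S.unit n‖ := by
        intro v hv
        apply ih
        · intro n
          rcases eq_or_ne n m with rfl | h
          · simp [hv]
          · simpa [h] using hl n
        · intro n hn
          rcases eq_or_ne n m with rfl | h
          · simp [hv]
          · simpa [h] using hT n (by simp [h, hn])
      have hdec : ∑ n ∈ F, (l n * a n) • S.unit n =
          (((1 + ‖l m‖) / 2 : ℝ) : 𝕂) • ∑ n ∈ F, (Function.update l m u n * a n) • S.unit n +
          (((1 - ‖l m‖) / 2 : ℝ) : 𝕂) •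
            ∑ n ∈ F, (Function.update l m (-u) n * a n) • S.unit n := by
        rw [Finset.smul_sum, Finset.smul_sum, ← Finset.sum_add_distrib]
        refine Finset.sum_congr rfl fun n _ => ?_
        rw [smul_smul, smul_smul, ← add_smul]
        congr 1
        rcases eq_or_ne n m with rfl | h
        · simp only [Function.update_self]
          nth_rewrite 1 [hlu]
          push_cast
          ring
        · simp only [Function.update_of_ne h]
          push_cast
          ring
      have hp : 0 ≤ (1 + ‖l m‖) / 2 := by positivity
      have hq : 0 ≤ (1 - ‖l m‖) / 2 := by linarith [hl m]
      rw [hdec]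
      refine (norm_add_le _ _).trans ?_
      rw [norm_smul, norm_smul, RCLike.norm_ofReal, RCLike.norm_ofReal, abs_of_nonneg hp,
        abs_of_nonneg hq]
      have h1 := mul_le_mul_of_nonneg_left (hv u hu) hp
      have h2 := mul_le_mul_of_nonneg_left (hv (-u) (by simpa using hu)) hq
      linarith
  let l' : ℕ → 𝕂 := fun n => if n ∈ F then l n else 1
  have h : ∑ n ∈ F, (l n * a n) • S.unit n = ∑ n ∈ F, (l' n * a n) • S.unit n :=
    Finset.sum_congr rfl fun n hn => by simp [l', hn]
  rw [h]
  refine key F l' (fun n => ?_) fun n hn => by simp [l', hn]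
  by_cases hn : n ∈ F
  · simpa [l', hn] using hl n
  · simp [l', hn]

/-- Solidity: `E` contains every sequence dominated by an element of `E`. -/
lemma IsOneUnconditional.solid [CompleteSpace E] (hS : S.IsOneUnconditional) (t : E)
    (s : ℕ → 𝕂) (hst : ∀ n, ‖s n‖ ≤ ‖S.coord t n‖) :
    ∃ u : E, S.coord u = s ∧ ‖u‖ ≤ ‖t‖ := by
  let l : ℕ → 𝕂 := fun n => s n / S.coord t n
  have hl : ∀ n, ‖l n‖ ≤ 1 := fun n => by
    rw [norm_div]
    exact div_le_one_of_le₀ (hst n) (norm_nonneg _)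
  have hs : ∀ n, s n = l n * S.coord t n := fun n => by
    rcases eq_or_ne (S.coord t n) 0 with h | h
    · have := hst n
      simp only [h, norm_zero, norm_le_zero_iff] at this
      simp [h, this]
    · simp [l, h]
  have hle : ∀ F : Finset ℕ,
      ‖∑ n ∈ F, s n • S.unit n‖ ≤ ‖∑ n ∈ F, S.coord t n • S.unit n‖ := fun F => by
    simpa only [← hs] using hS.norm_sum_le F (S.coord t) l hl
  have ht := hS.tendsto t
  have hc : CauchySeq fun N => ∑ n ∈ Finset.range N, s n • S.unit n := by
    have htc := ht.cauchySeq
    rw [Metric.cauchySeq_iff'] at htc ⊢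
    intro ε hε
    obtain ⟨N, hN⟩ := htc ε hε
    refine ⟨N, fun n hn => ?_⟩
    have h1 := hN n hn
    rw [dist_eq_norm, ← Finset.sum_sdiff_eq_sub (Finset.range_mono hn)] at h1 ⊢
    exact (hle _).trans_lt h1
  obtain ⟨u, hu⟩ := cauchySeq_tendsto_of_complete hc
  exact ⟨u, funext (coord_of_tendsto hu), le_of_tendsto_of_tendsto' hu.norm ht.norm fun N => hle _⟩

end SequenceSpace

/-! ### The `E`-sum of a sequence of normed spaces -/

section ESum

variable {𝕂 E : Type*} [RCLike 𝕂] [NormedAddCommGroup E] [NormedSpace 𝕂 E] [CompleteSpace E]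
  {S : SequenceSpace 𝕂 E}

/-- The additive group of all `x ∈ ∏ Xₙ` with `(‖xₙ‖)ₙ ∈ E`. -/
def eSumAddSubgroup (hS : S.IsOneUnconditional) (X : ℕ → Type*)
    [∀ n, NormedAddCommGroup (X n)] : AddSubgroup (∀ n, X n) where
  carrier := {x | ∃ t : E, ∀ n, S.coord t n = ((‖x n‖ : ℝ) : 𝕂)}
  zero_mem' := ⟨0, by simp⟩
  neg_mem' := by
    rintro x ⟨t, ht⟩
    exact ⟨t, by simpa using ht⟩
  add_mem' := by
    rintro x y ⟨t, ht⟩ ⟨s, hs⟩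
    obtain ⟨u, hu, -⟩ := hS.solid (t + s) (fun n => ((‖x n + y n‖ : ℝ) : 𝕂)) fun n => by
      rw [map_add, Pi.add_apply, ht, hs, ← RCLike.ofReal_add, RCLike.norm_ofReal,
        RCLike.norm_ofReal, abs_of_nonneg (norm_nonneg _), abs_of_nonneg (by positivity)]
      exact norm_add_le _ _
    exact ⟨u, fun n => congrFun hu n⟩

/-- The `E`-sum `[⨁ Xₙ]_E`: all sequences `x ∈ ∏ Xₙ` with `(‖xₙ‖)ₙ ∈ E`. -/
def ESum (hS : S.IsOneUnconditional) (X : ℕ → Type*) [∀ n, NormedAddCommGroup (X n)] : Type _ :=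
  eSumAddSubgroup hS X

namespace ESum

variable {hS : S.IsOneUnconditional} {X : ℕ → Type*} [∀ n, NormedAddCommGroup (X n)]

instance : AddCommGroup (ESum hS X) := inferInstanceAs (AddCommGroup (eSumAddSubgroup hS X))

/-- The underlying sequence of an element of the `E`-sum. -/
def toSeq : ESum hS X →+ ∀ n, X n := (eSumAddSubgroup hS X).subtype

lemma toSeq_injective : Function.Injective (toSeq : ESum hS X → ∀ n, X n) :=
  Subtype.val_injective

lemma exists_normSeq (x : ESum hS X) : ∃ t : E, ∀ n, S.coord t n = ((‖x.toSeq n‖ : ℝ) : 𝕂) := x.2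

/-- The element `(‖xₙ‖)ₙ` of `E`. -/
def normSeq (x : ESum hS X) : E := x.exists_normSeq.choose

lemma coord_normSeq (x : ESum hS X) (n : ℕ) :
    S.coord x.normSeq n = ((‖x.toSeq n‖ : ℝ) : 𝕂) := x.exists_normSeq.choose_spec n

lemma norm_le_of_coord_le {t s : E} (h : ∀ n, ‖S.coord t n‖ ≤ ‖S.coord s n‖)
    (hS : S.IsOneUnconditional) : ‖t‖ ≤ ‖s‖ := by
  obtain ⟨u, hu, hu'⟩ := hS.solid s (S.coord t) h
  rwa [← S.coord_injective hu]

/-- The norm `‖x‖ = ‖(‖xₙ‖)ₙ‖_E` of the `E`-sum. -/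
instance : NormedAddCommGroup (ESum hS X) :=
  AddGroupNorm.toNormedAddCommGroup
    { toFun := fun x => ‖x.normSeq‖
      map_zero' := by
        have : (0 : ESum hS X).normSeq = 0 := S.coord_injective (by ext n; simp [coord_normSeq])
        simp [this]
      add_le' := fun x y => by
        refine (norm_le_of_coord_le (s := x.normSeq + y.normSeq) (fun n => ?_) hS).trans
          (norm_add_le _ _)
        rw [map_add, Pi.add_apply, coord_normSeq, coord_normSeq, coord_normSeq,
          ← RCLike.ofReal_add, RCLike.norm_ofReal,
          RCLike.norm_ofReal, abs_of_nonneg (norm_nonneg _), abs_of_nonneg (by positivity), map_add]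
        exact norm_add_le _ _
      neg' := fun x => by
        have : (-x).normSeq = x.normSeq := S.coord_injective (by ext n; simp [coord_normSeq])
        simp [this]
      eq_zero_of_map_eq_zero' := fun x hx => by
        apply toSeq_injective
        funext n
        have h := coord_normSeq x n
        rw [norm_eq_zero.1 hx] at h
        simpa using h.symm }

lemma norm_def (x : ESum hS X) : ‖x‖ = ‖x.normSeq‖ := rfl

section Module

variable {𝕜 : Type*} [NormedField 𝕜] [∀ n, NormedSpace 𝕜 (X n)]

instance : SMul 𝕜 (ESum hS X) where
  smul c x := ⟨c • x.toSeq, ((‖c‖ : ℝ) : 𝕂) • x.normSeq, fun n => by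
    simp [coord_normSeq, norm_smul]⟩

@[simp]
lemma toSeq_smul (c : 𝕜) (x : ESum hS X) : (c • x).toSeq = c • x.toSeq := rfl

instance : Module 𝕜 (ESum hS X) :=
  Function.Injective.module 𝕜 toSeq toSeq_injective toSeq_smul

instance : NormedSpace 𝕜 (ESum hS X) where
  norm_smul_le c x := by
    have h : (c • x).normSeq = ((‖c‖ : ℝ) : 𝕂) • x.normSeq :=
      S.coord_injective (by ext n; simp [coord_normSeq, norm_smul])
    rw [norm_def, norm_def, h, norm_smul]
    simp

end Module

instance {𝕜 : Type*} [RCLike 𝕜] [∀ n, NormedSpace 𝕜 (X n)] [∀ n, NormedSpace ℝ (X n)]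
    [∀ n, IsScalarTower ℝ 𝕜 (X n)] : IsScalarTower ℝ 𝕜 (ESum hS X) where
  smul_assoc r c x := toSeq_injective (by simp)

end ESum

end ESum

end

/-! ### Slices and continuous linear maps -/

section Slices

variable {𝕜 : Type*} [RCLike 𝕜] {Z W X : Type*} [NormedAddCommGroup Z] [NormedSpace 𝕜 Z]
  [NormedAddCommGroup W] [NormedSpace 𝕜 W] [NormedAddCommGroup X] [NormedSpace 𝕜 X]

/-! A functional on the `E`-sum has components whose norms define a functional on `E`. As the basis
of `E` is shrinking, that functional is small on tails, so every functional on the sum is uniformly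
small on tails of bounded sets (`exists_norm_apply_sub_trunc_le`). By Hahn–Banach separation it then
suffices to find, for each `N`, countably many slices of `A` such that every `B` meeting them has a
convex hull that approximates each point of `A` after truncation to the first `N` coordinates; the
union over `N` is countable.

These slices come from induction on `N`. `SliceDetermined.prod` adds one SCD coordinate, in two
stages: slices of the new coordinate, then slices of the half-space sections they cut out.
`exists_mem_convexHull_of_rationalSlices` turns the resulting intersections of two half-spaces back
into countably many slices of `A`. -/

lemma slice_nonempty {A : Set Z} (hA : A.Nonempty) (f : StrongDual 𝕜 Z) {ε : ℝ} (hε : 0 < ε) :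
    (slice 𝕜 A f ε).Nonempty := by
  obtain ⟨_, ⟨a, ha, rfl⟩, h⟩ := exists_lt_of_lt_csSup
    (hA.image fun a => RCLike.re (f a)) (sub_lt_self _ hε)
  exact ⟨a, ha, h⟩

lemma bddAbove_re_image {A : Set Z} (hA : Bornology.IsBounded A) (f : StrongDual 𝕜 Z) :
    BddAbove ((fun a => RCLike.re (f a)) '' A) := by
  obtain ⟨C, hC⟩ := hA.exists_norm_le
  refine ⟨‖f‖ * C, ?_⟩
  rintro _ ⟨a, ha, rfl⟩
  exact (RCLike.re_le_norm _).trans ((f.le_opNorm a).trans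
    (mul_le_mul_of_nonneg_left (hC a ha) (norm_nonneg _)))

lemma re_sub_lt_of_mem_slice {A : Set Z} (hA : Bornology.IsBounded A) {f : StrongDual 𝕜 Z} {ε : ℝ}
    {a b : Z} (ha : a ∈ A) (hb : b ∈ slice 𝕜 A f ε) : RCLike.re (f a) - ε < RCLike.re (f b) := by
  have h : RCLike.re (f a) ≤ sSup ((fun a => RCLike.re (f a)) '' A) :=
    le_csSup (bddAbove_re_image hA f) ⟨a, ha, rfl⟩
  have := hb.2
  linarith

/-- The slices given by the rational combinations of two functionals. -/
noncomputable def rationalSlices (f h : StrongDual 𝕜 Z) : Set (StrongDual 𝕜 Z × ℝ) :=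
  Set.range fun p : (ℚ × ℚ) × ℕ =>
    ((((p.1.1 : ℝ) : 𝕜) • f + ((p.1.2 : ℝ) : 𝕜) • h), 1 / ((p.2 : ℝ) + 1))

lemma countable_rationalSlices (f h : StrongDual 𝕜 Z) : (rationalSlices f h).Countable :=
  Set.countable_range _

lemma pos_of_mem_rationalSlices {f h : StrongDual 𝕜 Z} {p : StrongDual 𝕜 Z × ℝ}
    (hp : p ∈ rationalSlices f h) : 0 < p.2 := by
  obtain ⟨q, rfl⟩ := hp
  positivity

variable [NormedSpace ℝ Z]

/-- There are countably many slices of `A` such that `P '' A` lies in the closed convex hull of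
`P '' B` for every `B ⊆ A` that meets all of them. -/
def SliceDetermined (A : Set Z) (P : Z →L[𝕜] W) : Prop :=
  ∃ 𝒮 : Set (StrongDual 𝕜 Z × ℝ), 𝒮.Countable ∧ (∀ p ∈ 𝒮, 0 < p.2) ∧
    ∀ B ⊆ A, (∀ p ∈ 𝒮, (B ∩ slice 𝕜 A p.1 p.2).Nonempty) →
      ∀ a ∈ A, ∀ ε > 0, ∃ b ∈ convexHull ℝ B, ‖P b - P a‖ < ε

lemma SliceDetermined.comp {A : Set Z} {P : Z →L[𝕜] W} (h : SliceDetermined A P)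
    (R : W →L[𝕜] X) : SliceDetermined A (R.comp P) := by
  obtain ⟨𝒮, h1, h2, h3⟩ := h
  refine ⟨𝒮, h1, h2, fun B hB hBS a ha ε hε => ?_⟩
  obtain ⟨b, hb, hb'⟩ := h3 B hB hBS a ha (ε / (‖R‖ + 1)) (by positivity)
  refine ⟨b, hb, ?_⟩
  rw [lt_div_iff₀ (by positivity)] at hb'
  have := R.le_opNorm (P b - P a)
  rw [map_sub] at this
  simp only [ContinuousLinearMap.comp_apply]
  nlinarith [norm_nonneg (P b - P a)]

variable [IsScalarTower ℝ 𝕜 Z]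

/-- The real part of a functional, as a real functional. -/
noncomputable def reDual (f : StrongDual 𝕜 Z) : StrongDual ℝ Z :=
  RCLike.reCLM.comp (f.restrictScalars ℝ)

@[simp]
lemma reDual_apply (f : StrongDual 𝕜 Z) (x : Z) : reDual f x = RCLike.re (f x) := rfl

/-- A special case of Bourgain's lemma: if `B` meets all slices given by rational combinations of
`f` and `h`, then its convex hull meets every nonempty set `{a ∈ A | γ < Re f a, δ < Re h a}`. -/
lemma exists_mem_convexHull_of_rationalSlices {A B : Set Z} (hA : Bornology.IsBounded A)
    {f h : StrongDual 𝕜 Z}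
    (hB : ∀ p ∈ rationalSlices f h, (B ∩ slice 𝕜 A p.1 p.2).Nonempty) {γ δ : ℝ} {a : Z}
    (ha : a ∈ A) (hγ : γ < RCLike.re (f a)) (hδ : δ < RCLike.re (h a)) :
    ∃ b ∈ convexHull ℝ B, γ < RCLike.re (f b) ∧ δ < RCLike.re (h b) := by
  by_contra! hcon
  let F : Z →L[ℝ] ℝ × ℝ := (reDual f).prod (reDual h)
  have hdisj : Disjoint (Set.Ioi γ ×ˢ Set.Ioi δ) (F '' convexHull ℝ B) := by
    rw [Set.disjoint_left]
    rintro _ ⟨h1, h2⟩ ⟨b, hb, rfl⟩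
    exact (hcon b hb h1).not_gt h2
  -- Separation in the plane: `l` takes a value below `u` at the image of `a` and values at least
  -- `u` on the image of `B`. So `-l ∘ F` has a slice missed by `B`; making its coefficients
  -- rational yields the contradiction.
  obtain ⟨l, u, hl, hu⟩ := geometric_hahn_banach_open
    ((convex_Ioi γ).prod (convex_Ioi δ)) (isOpen_Ioi.prod isOpen_Ioi)
    ((convex_convexHull ℝ B).linear_image (F : Z →ₗ[ℝ] ℝ × ℝ)) hdisj
  have hla : l (F a) < u := hl _ ⟨hγ, hδ⟩
  have hle : ∀ x, l (F x) = RCLike.re (f x) * l (1, 0) + RCLike.re (h x) * l (0, 1) := by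
    intro x
    have : F x = RCLike.re (f x) • ((1, 0) : ℝ × ℝ) + RCLike.re (h x) • ((0, 1) : ℝ × ℝ) := by
      ext <;> simp [F]
    rw [this, map_add, map_smul, map_smul, smul_eq_mul, smul_eq_mul]
  obtain ⟨C, hC⟩ := hA.exists_norm_le
  set M : ℝ := (‖f‖ + ‖h‖) * C with hM
  have hC0 : 0 ≤ C := (norm_nonneg a).trans (hC a ha)
  have hM0 : 0 ≤ M := by positivity
  have hfM : ∀ x ∈ A, |RCLike.re (f x)| ≤ M := fun x hx =>
    (RCLike.abs_re_le_norm _).trans ((f.le_opNorm_of_le (hC x hx)).trans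
      (mul_le_mul_of_nonneg_right (by linarith [norm_nonneg h]) hC0))
  have hhM : ∀ x ∈ A, |RCLike.re (h x)| ≤ M := fun x hx =>
    (RCLike.abs_re_le_norm _).trans ((h.le_opNorm_of_le (hC x hx)).trans
      (mul_le_mul_of_nonneg_right (by linarith [norm_nonneg f]) hC0))
  set η := u - l (F a) with hη
  have hη0 : 0 < η := by linarith
  -- Rounding two coefficients, at `a` and at `b`, gives four errors of at most `η / 8`. With a
  -- slice width below `η / 4` the total stays below the gap `η`.
  have hκ : 0 < η / (8 * (M + 1)) := by positivity
  obtain ⟨q, hq1, hq2⟩ := exists_rat_btwn (show -l (1, 0) - η / (8 * (M + 1)) < -l (1, 0) by linarith)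
  obtain ⟨r, hr1, hr2⟩ := exists_rat_btwn (show -l (0, 1) - η / (8 * (M + 1)) < -l (0, 1) by linarith)
  obtain ⟨n, hn⟩ := exists_nat_one_div_lt (show 0 < η / 4 by linarith)
  obtain ⟨b, hbB, hb⟩ := hB _ ⟨((q, r), n), rfl⟩
  have h1 := re_sub_lt_of_mem_slice hA ha hb
  have h2 : u ≤ l (F b) := hu _ ⟨b, subset_convexHull ℝ B hbB, rfl⟩
  simp only [add_apply, smul_apply, map_add, smul_eq_mul,
    RCLike.re_ofReal_mul] at h1
  rw [hle] at h2
  have hla' : l (F a) = u - η := by ring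
  rw [hle] at hla'
  have hbA := hb.1
  have key : ∀ (s t d : ℝ) (x : ℝ), -s - d < t → t < -s → |x| ≤ M → |(t + s) * x| ≤ d * M := by
    intro s t d x h1 h2 hx
    rw [abs_mul]
    exact mul_le_mul (abs_le.2 ⟨by linarith, by linarith⟩) hx (abs_nonneg _) (by linarith)
  have hd : η / (8 * (M + 1)) * M ≤ η / 8 := by
    rw [div_mul_eq_mul_div, div_le_div_iff₀ (by positivity) (by norm_num)]
    nlinarith
  have k1 := abs_le.1 (key _ _ _ _ hq1 hq2 (hfM a ha))
  have k2 := abs_le.1 (key _ _ _ _ hq1 hq2 (hfM b hbA))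
  have k3 := abs_le.1 (key _ _ _ _ hr1 hr2 (hhM a ha))
  have k4 := abs_le.1 (key _ _ _ _ hr1 hr2 (hhM b hbA))
  nlinarith [k1.1, k1.2, k2.1, k2.2, k3.1, k3.2, k4.1, k4.2]

/-! ### Adding one SCD coordinate -/

variable [NormedSpace ℝ W] [IsScalarTower ℝ 𝕜 W] [NormedSpace ℝ X] [IsScalarTower ℝ 𝕜 X]

lemma convex_re_gt {A : Set Z} (hA : Convex ℝ A) (f : StrongDual 𝕜 Z) (γ : ℝ) :
    Convex ℝ {a ∈ A | γ < RCLike.re (f a)} :=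
  hA.inter ((convex_Ioi γ).linear_preimage (reDual f : Z →ₗ[ℝ] ℝ))

/-- Separability of `W` gives countably many small balls that localise `Q`. Over each ball, the SCD
property controls `P`. The ball condition is not given by slices; it is recovered by applying `hQ`
to each section of `A` by a half-space pulled back along `P`. -/
lemma SliceDetermined.prod [TopologicalSpace.SeparableSpace W] {Q : Z →L[𝕜] W}
    (hQ : ∀ A : Set Z, Convex ℝ A → Bornology.IsBounded A → SliceDetermined A Q)
    (hX : ∀ A : Set X, Convex ℝ A → Bornology.IsBounded A → IsSCDSet 𝕜 A) (P : Z →L[𝕜] X)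
    {A : Set Z} (hA : Convex ℝ A) (hAb : Bornology.IsBounded A) :
    SliceDetermined A (Q.prod P) := by
  let c := TopologicalSpace.denseSeq W
  let r : ℕ → ℝ := fun n => 1 / ((n : ℝ) + 1)
  have hr : ∀ n, 0 < r n := fun n => by positivity
  let A' : ℕ → ℕ → Set Z := fun i n => A ∩ Q ⁻¹' Metric.ball (c i) (r n)
  have hA' : ∀ i n, Convex ℝ (A' i n) := fun i n =>
    hA.inter ((convex_ball _ _).linear_preimage (Q.restrictScalars ℝ : Z →ₗ[ℝ] W))
  have hPA' : ∀ i n, Convex ℝ (P '' A' i n) := fun i n =>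
    (hA' i n).linear_image (P.restrictScalars ℝ : Z →ₗ[ℝ] X)
  have hPAb : ∀ i n, Bornology.IsBounded (P '' A' i n) := fun i n =>
    P.lipschitz.isBounded_image (hAb.subset Set.inter_subset_left)
  choose g ε hε hg using fun i n => hX (P '' A' i n) (hPA' i n) (hPAb i n)
  let γ : ℕ → ℕ → ℕ → ℝ := fun i n j =>
    sSup ((fun x => RCLike.re (g i n j x)) '' (P '' A' i n)) - ε i n j
  -- The threshold comes from the part of `A` over the ball, but the section is taken in all of `A`,
  -- so that its own slices are intersections of `A` with two half-spaces.
  let G : ℕ → ℕ → ℕ → Set Z := fun i n j =>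
    {a ∈ A | γ i n j < RCLike.re ((g i n j).comp P a)}
  have hG : ∀ i n j, Convex ℝ (G i n j) := fun i n j => convex_re_gt hA _ _
  have hGA : ∀ i n j, G i n j ⊆ A := fun i n j => Set.sep_subset _ _
  choose 𝒯 h𝒯c h𝒯p h𝒯 using fun i n j => hQ (G i n j) (hG i n j) (hAb.subset (hGA i n j))
  refine ⟨⋃ (i) (n) (j), ⋃ p ∈ 𝒯 i n j, rationalSlices ((g i n j).comp P) p.1, ?_, ?_, ?_⟩
  · exact Set.countable_iUnion fun i => Set.countable_iUnion fun n => Set.countable_iUnion fun j =>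
      (h𝒯c i n j).biUnion fun p _ => countable_rationalSlices _ _
  · intro p hp
    simp only [Set.mem_iUnion] at hp
    obtain ⟨i, n, j, q, hq, hp⟩ := hp
    exact pos_of_mem_rationalSlices hp
  intro B hBA hB a ha e he
  set K := convexHull ℝ B with hK
  have hKA : K ⊆ A := convexHull_min hBA hA
  have hKc : Convex ℝ K := convex_convexHull ℝ B
  obtain ⟨n, hn⟩ := exists_nat_one_div_lt (show 0 < e / 2 by linarith)
  obtain ⟨i, hi⟩ : ∃ i, dist (Q a) (c i) < r n :=
    (TopologicalSpace.denseRange_denseSeq W).exists_dist_lt (Q a) (hr n)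
  let B' : Set Z := K ∩ Q ⁻¹' Metric.ball (c i) (r n)
  have hB' : Convex ℝ (P '' B') :=
    (hKc.inter ((convex_ball _ _).linear_preimage (Q.restrictScalars ℝ : Z →ₗ[ℝ] W))).linear_image
      (P.restrictScalars ℝ : Z →ₗ[ℝ] X)
  have hB'A : B' ⊆ A' i n := Set.inter_subset_inter_left _ hKA
  have hmeet : ∀ j, ((P '' B') ∩ slice 𝕜 (P '' A' i n) (g i n j) (ε i n j)).Nonempty := by
    intro j
    obtain ⟨_, ⟨a', ha', rfl⟩, hs⟩ := slice_nonempty (𝕜 := 𝕜) (A := P '' A' i n)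
      ⟨P a, a, ⟨ha, hi⟩, rfl⟩ (g i n j) (hε i n j)
    have ha'G : a' ∈ G i n j := ⟨ha'.1, hs⟩
    have ha'b : dist (Q a') (c i) < r n := ha'.2
    -- The tolerance `r n - dist (Q a') (c i)` forces `Q b` to stay in the ball.
    obtain ⟨b, hb, hbQ⟩ := h𝒯 i n j (K ∩ G i n j) Set.inter_subset_right (by
      intro p hp
      obtain ⟨v, hv, hv'⟩ := slice_nonempty ⟨a', ha'G⟩ p.1 (h𝒯p i n j p hp)
      obtain ⟨b, hb, hb1, hb2⟩ := exists_mem_convexHull_of_rationalSlices (B := B) hAb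
        (fun q hq => hB q (by
          simp only [Set.mem_iUnion]
          exact ⟨i, n, j, p, hp, hq⟩)) hv.1 hv.2 hv'
      have hbG : b ∈ G i n j := ⟨hKA hb, hb1⟩
      exact ⟨b, ⟨hb, hbG⟩, hbG, hb2⟩) a' ha'G (r n - dist (Q a') (c i)) (by linarith)
    rw [(hKc.inter (hG i n j)).convexHull_eq] at hb
    have hbb : dist (Q b) (c i) < r n := by
      have := dist_triangle (Q b) (Q a') (c i)
      rw [dist_eq_norm (Q b)  (Q a')] at this
      linarith
    exact ⟨P b, ⟨b, ⟨hb.1, hbb⟩, rfl⟩, ⟨b, ⟨hKA hb.1, hbb⟩, rfl⟩, hb.2.2⟩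
  -- The approximation of `P a` now uses only points of `K` over the ball, where `Q` differs from `Q
  -- a` by less than `2 * r n < e`.
  have hcl := (hg i n).2 (P '' B') (Set.image_mono hB'A) hmeet ⟨a, ⟨ha, hi⟩, rfl⟩
  rw [hB'.convexHull_eq, Metric.mem_closure_iff] at hcl
  obtain ⟨_, ⟨b, hb, rfl⟩, hbP⟩ := hcl e he
  refine ⟨b, hb.1, ?_⟩
  have hbQ : dist (Q b) (c i) < r n := hb.2
  have h1 : ‖Q b - Q a‖ < e := by
    rw [← dist_eq_norm]
    have := dist_triangle_right (Q b) (Q a) (c i)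
    have : r n < e / 2 := hn
    linarith
  have h2 : ‖P b - P a‖ < e := by rwa [← dist_eq_norm, dist_comm]
  simpa [Prod.norm_def] using ⟨h1, h2⟩

end Slices

/-! ### The `E`-sum as a Banach space -/

namespace ESum

variable {𝕂 E : Type*} [RCLike 𝕂] [NormedAddCommGroup E] [NormedSpace 𝕂 E] [CompleteSpace E]
  {S : SequenceSpace 𝕂 E} {hS : S.IsOneUnconditional} {X : ℕ → Type*}
  [∀ n, NormedAddCommGroup (X n)]

lemma norm_coord_normSeq (x : ESum hS X) (n : ℕ) : ‖S.coord x.normSeq n‖ = ‖x.toSeq n‖ := by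
  rw [coord_normSeq, RCLike.norm_ofReal, abs_norm]

lemma norm_le_of_norm_le_coord (x : ESum hS X) (t : E) (h : ∀ n, ‖x.toSeq n‖ ≤ ‖S.coord t n‖) :
    ‖x‖ ≤ ‖t‖ :=
  norm_le_of_coord_le (fun n => by rw [norm_coord_normSeq]; exact h n) hS

lemma norm_le_norm_of_toSeq_le {x y : ESum hS X} (h : ∀ n, ‖x.toSeq n‖ ≤ ‖y.toSeq n‖) :
    ‖x‖ ≤ ‖y‖ :=
  x.norm_le_of_norm_le_coord _ fun n => by rw [norm_coord_normSeq]; exact h n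

variable (hS) in
lemma exists_toSeq_eq (x : ∀ n, X n) (t : E) (h : ∀ n, ‖x n‖ ≤ ‖S.coord t n‖) :
    ∃ z : ESum hS X, z.toSeq = x := by
  obtain ⟨u, hu, -⟩ := hS.solid t (fun n => ((‖x n‖ : ℝ) : 𝕂)) fun n => by
    rw [RCLike.norm_ofReal, abs_norm]
    exact h n
  exact ⟨⟨x, u, fun n => congrFun hu n⟩, rfl⟩

lemma norm_toSeq_mul_le (x : ESum hS X) (n : ℕ) : ‖x.toSeq n‖ * ‖S.unit n‖ ≤ ‖x‖ := by
  have := S.norm_coord_smul_unit_le x.normSeq n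
  rwa [norm_smul, norm_coord_normSeq] at this

theorem completeSpace (hX : ∀ n, CompleteSpace (X n)) : CompleteSpace (ESum hS X) := by
  refine NormedAddCommGroup.completeSpace_of_summable_imp_tendsto fun u hu => ?_
  -- The norm sequences of an absolutely convergent series sum to `t` in `E`. The remainders in `E`
  -- dominate those of the coordinatewise series, so solidity gives both membership of its sum and
  -- convergence.
  obtain ⟨t, ht⟩ : Summable fun k => (u k).normSeq := .of_norm hu
  have hcoord : ∀ n, HasSum (fun k => ‖(u k).toSeq n‖) (RCLike.re (S.coord t n)) := by
    intro n
    let L : E →+ 𝕂 := ((LinearMap.proj n).comp S.coord : E →ₗ[𝕂] 𝕂).toAddMonoidHom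
    have h := (ht.map L (S.continuous_coord n)).map (RCLike.re : 𝕂 →+ ℝ)
      RCLike.continuous_re
    refine h.congr_fun fun k => ?_
    change _ = RCLike.re (S.coord (u k).normSeq n)
    rw [coord_normSeq, RCLike.ofReal_re]
  have hs : ∀ n, Summable fun k => (u k).toSeq n := fun n => .of_norm (hcoord n).summable
  have hle : ∀ n K, ‖(∑' k, (u k).toSeq n) - ∑ k ∈ Finset.range K, (u k).toSeq n‖ ≤
      ‖S.coord (t - ∑ k ∈ Finset.range K, (u k).normSeq) n‖ := by
    intro n K
    have h1 := (hs n).sum_add_tsum_nat_add K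
    have h2 := (hcoord n).summable.sum_add_tsum_nat_add K
    rw [(hcoord n).tsum_eq] at h2
    rw [← h1, add_sub_cancel_left]
    have h3 : Summable fun k => ‖(u (k + K)).toSeq n‖ :=
      (summable_nat_add_iff (f := fun k => ‖(u k).toSeq n‖) K).2 (hcoord n).summable
    refine (norm_tsum_le_tsum_norm h3).trans ?_
    refine le_trans (le_of_eq ?_) (RCLike.re_le_norm _)
    simp only [map_sub, map_sum, Pi.sub_apply, Finset.sum_apply, coord_normSeq, RCLike.ofReal_re]
    linarith
  obtain ⟨z, hz⟩ := exists_toSeq_eq hS (fun n => ∑' k, (u k).toSeq n) t fun n => by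
    simpa using hle n 0
  refine ⟨z, tendsto_iff_norm_sub_tendsto_zero.2 ?_⟩
  have h0 := tendsto_iff_norm_sub_tendsto_zero.1 ht.tendsto_sum_nat
  refine squeeze_zero (fun _ => norm_nonneg _) (fun K => ?_) h0
  rw [norm_sub_rev, norm_sub_rev _ t]
  refine norm_le_of_norm_le_coord _ _ fun n => ?_
  simpa [hz, map_sum, Finset.sum_apply] using hle n K

/-! ### Coordinate maps and truncations -/

variable {𝕜 : Type*} [RCLike 𝕜] [∀ n, NormedSpace 𝕜 (X n)]

variable (𝕜 hS X) in
/-- The inclusion of the `n`-th space into the `E`-sum. -/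
noncomputable def single (n : ℕ) : X n →L[𝕜] ESum hS X :=
  LinearMap.mkContinuous
    { toFun := fun x => ⟨Pi.single n x, ((‖x‖ : ℝ) : 𝕂) • S.unit n, fun m => by
        rcases eq_or_ne m n with rfl | h
        · simp [S.coord_unit]
        · simp [S.coord_unit, Pi.single_eq_of_ne h]⟩
      map_add' := fun x y => toSeq_injective (Pi.single_add n x y)
      map_smul' := fun c x => toSeq_injective (Pi.single_smul n c x) }
    ‖S.unit n‖ fun x => by
      refine (norm_le_of_norm_le_coord _ (((‖x‖ : ℝ) : 𝕂) • S.unit n) fun m => ?_).trans ?_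
      · change ‖(Pi.single n x : ∀ n, X n) m‖ ≤ _
        rcases eq_or_ne m n with rfl | h
        · simp [S.coord_unit]
        · simp [S.coord_unit, Pi.single_eq_of_ne h]
      · rw [norm_smul, RCLike.norm_ofReal, abs_norm, mul_comm]

lemma toSeq_single (n : ℕ) (x : X n) : (single hS X 𝕜 n x).toSeq = Pi.single n x := rfl

variable (𝕜 hS X) in
/-- The `n`-th coordinate of an element of the `E`-sum. -/
noncomputable def proj (n : ℕ) : ESum hS X →L[𝕜] X n :=
  LinearMap.mkContinuous
    { toFun := fun x => x.toSeq n
      map_add' := fun x y => by simp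
      map_smul' := fun c x => by simp }
    (‖S.unit n‖⁻¹) fun x => by
      rw [inv_mul_eq_div, le_div_iff₀ (norm_pos_iff.2 (S.unit_ne_zero n))]
      exact norm_toSeq_mul_le x n

lemma proj_apply (n : ℕ) (x : ESum hS X) : proj hS X 𝕜 n x = x.toSeq n := rfl

variable (𝕜 hS X) in
/-- The truncation of an element of the `E`-sum to its first `N` coordinates. -/
noncomputable def trunc (N : ℕ) : ESum hS X →L[𝕜] ESum hS X :=
  ∑ n ∈ Finset.range N, (single hS X 𝕜 n).comp (proj hS X 𝕜 n)

lemma trunc_apply (N : ℕ) (x : ESum hS X) :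
    trunc hS X 𝕜 N x = ∑ n ∈ Finset.range N, single hS X 𝕜 n (x.toSeq n) := by
  simp [trunc, sum_apply, proj_apply]

lemma toSeq_trunc (N : ℕ) (x : ESum hS X) (m : ℕ) :
    (trunc hS X 𝕜 N x).toSeq m = if m < N then x.toSeq m else 0 := by
  rw [trunc_apply, map_sum, Finset.sum_apply]
  simp only [toSeq_single, Finset.sum_pi_single, Finset.mem_range]

lemma toSeq_sub_trunc (N : ℕ) (x : ESum hS X) (m : ℕ) :
    (x - trunc hS X 𝕜 N x).toSeq m = if m < N then 0 else x.toSeq m := by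
  rw [map_sub, Pi.sub_apply, toSeq_trunc]
  split_ifs <;> simp

lemma norm_sub_trunc_le (N : ℕ) (x : ESum hS X) : ‖x - trunc hS X 𝕜 N x‖ ≤ ‖x‖ := by
  refine norm_le_norm_of_toSeq_le fun m => ?_
  rw [toSeq_sub_trunc]
  split_ifs <;> simp

/-- The norm sequence of the remainder is the remainder of the basis expansion of `x.normSeq`. -/
lemma tendsto_trunc (x : ESum hS X) :
    Tendsto (fun N => trunc hS X 𝕜 N x) atTop (𝓝 x) := by
  refine tendsto_iff_norm_sub_tendsto_zero.2 ?_
  refine squeeze_zero (fun _ => norm_nonneg _) (fun N => ?_)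
    (tendsto_iff_norm_sub_tendsto_zero.1 (hS.tendsto x.normSeq))
  rw [norm_sub_rev, norm_sub_rev _ x.normSeq]
  refine norm_le_of_norm_le_coord _ _ fun m => ?_
  rw [toSeq_sub_trunc, map_sub, Pi.sub_apply, S.coord_sum]
  simp only [Finset.mem_range]
  split_ifs
  · simp
  · rw [sub_zero, norm_coord_normSeq]

theorem separableSpace (𝕜 : Type*) [RCLike 𝕜] [∀ n, NormedSpace 𝕜 (X n)]
    (hX : ∀ n, TopologicalSpace.SeparableSpace (X n)) :
    TopologicalSpace.SeparableSpace (ESum hS X) := by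
  have h1 : TopologicalSpace.IsSeparable (⋃ n, Set.range (single hS X 𝕜 n)) :=
    .iUnion fun n => TopologicalSpace.isSeparable_range (single hS X 𝕜 n).continuous
  have h2 := (h1.span (R := 𝕜)).closure
  refine TopologicalSpace.isSeparable_univ_iff.1 (h2.mono fun x _ => ?_)
  refine mem_closure_of_tendsto (tendsto_trunc (𝕜 := 𝕜) x) (.of_forall fun N => ?_)
  rw [trunc_apply]
  exact Submodule.sum_mem _ fun n _ => Submodule.subset_span (Set.mem_iUnion.2 ⟨n, _, rfl⟩)

/-! ### Functionals on the `E`-sum -/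

lemma sum_norm_apply_single_le (f : StrongDual 𝕜 (ESum hS X)) (F : Finset ℕ) (t : E)
    (y : ∀ n, X n) (hy : ∀ n, ‖y n‖ ≤ ‖S.coord t n‖) :
    ∑ n ∈ F, ‖f (single hS X 𝕜 n (y n))‖ ≤ ‖f‖ * ‖t‖ := by
  have hθ : ∀ z : 𝕜, ∃ θ : 𝕜, ‖θ‖ ≤ 1 ∧ θ * z = (‖z‖ : 𝕜) := fun z => by
    rcases eq_or_ne z 0 with rfl | h
    · exact ⟨0, by simp, by simp⟩
    · exact ⟨(‖z‖ : 𝕜) / z, by simp [h], by field_simp⟩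
  choose θ hθ1 hθ2 using hθ
  -- Scalars of modulus at most one align the terms, so that `f w` is the sum of the absolute
  -- values; solidity keeps `‖w‖ ≤ ‖t‖`.
  let w : ESum hS X := ∑ n ∈ F, single hS X 𝕜 n (θ (f (single hS X 𝕜 n (y n))) • y n)
  have hfw : f w = ((∑ n ∈ F, ‖f (single hS X 𝕜 n (y n))‖ : ℝ) : 𝕜) := by
    simp only [w, map_sum, map_smul, smul_eq_mul, hθ2]
  have hw : ‖w‖ ≤ ‖t‖ := by
    refine norm_le_of_norm_le_coord _ _ fun m => ?_
    simp only [w, map_sum, Finset.sum_apply, toSeq_single, Finset.sum_pi_single]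
    split_ifs
    · refine le_trans ?_ (hy m)
      simp only [norm_smul]
      exact mul_le_of_le_one_left (norm_nonneg _) (hθ1 _)
    · simp
  have := f.le_opNorm w
  rw [hfw, RCLike.norm_ofReal, abs_of_nonneg (Finset.sum_nonneg fun _ _ => norm_nonneg _)] at this
  exact this.trans (mul_le_mul_of_nonneg_left hw (norm_nonneg _))

lemma sum_norm_comp_single_le (f : StrongDual 𝕜 (ESum hS X)) (F : Finset ℕ) (t : E) :
    ∑ n ∈ F, ‖S.coord t n‖ * ‖f.comp (single hS X 𝕜 n)‖ ≤ ‖f‖ * ‖t‖ := by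
  refine le_of_forall_pos_le_add fun ε hε => ?_
  let M := ∑ n ∈ F, ‖S.coord t n‖
  have hM : 0 ≤ M := Finset.sum_nonneg fun _ _ => norm_nonneg _
  have hη : 0 < ε / (M + 1) := by positivity
  -- The component norms need not be attained, so near-maximisers in the unit ball are used; the
  -- total loss is at most `ε`.
  choose u hu hu' using fun n => (f.comp (single hS X 𝕜 n)).exists_lt_apply_of_lt_opNorm
    (sub_lt_self ‖f.comp (single hS X 𝕜 n)‖ hη)
  have h := sum_norm_apply_single_le f F t (fun n => ((‖S.coord t n‖ : ℝ) : 𝕜) • u n) fun n => by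
    rw [norm_smul, RCLike.norm_ofReal, abs_norm]
    exact mul_le_of_le_one_right (norm_nonneg _) (hu n).le
  have h2 : ∑ n ∈ F, ‖S.coord t n‖ * ‖f.comp (single hS X 𝕜 n)‖ ≤
      ∑ n ∈ F, (‖f (single hS X 𝕜 n (((‖S.coord t n‖ : ℝ) : 𝕜) • u n))‖ +
        ‖S.coord t n‖ * (ε / (M + 1))) := by
    refine Finset.sum_le_sum fun n _ => ?_
    rw [map_smul, map_smul, norm_smul, RCLike.norm_ofReal, abs_norm, ← mul_add]
    refine mul_le_mul_of_nonneg_left ?_ (norm_nonneg _)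
    have := hu' n
    rw [ContinuousLinearMap.comp_apply] at this
    linarith
  rw [Finset.sum_add_distrib, ← Finset.sum_mul] at h2
  have h3 : M * (ε / (M + 1)) ≤ ε := by
    rw [← mul_div_assoc, div_le_iff₀ (by positivity)]
    nlinarith
  linarith

/-- The functional `t ↦ ∑ tₙ ‖fₙ‖` on `E` given by the components `fₙ` of a functional on the
`E`-sum. -/
lemma exists_dual_hasSum (f : StrongDual 𝕜 (ESum hS X)) :
    ∃ g : StrongDual 𝕂 E, ∀ t, HasSum
      (fun n => S.coord t n * ((‖f.comp (single hS X 𝕜 n)‖ : ℝ) : 𝕂)) (g t) := by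
  have hn : ∀ (t : E) n, ‖S.coord t n * ((‖f.comp (single hS X 𝕜 n)‖ : ℝ) : 𝕂)‖ =
      ‖S.coord t n‖ * ‖f.comp (single hS X 𝕜 n)‖ := fun t n => by
    rw [norm_mul, RCLike.norm_ofReal, abs_norm]
  have hs : ∀ t : E, Summable fun n =>
      ‖S.coord t n * ((‖f.comp (single hS X 𝕜 n)‖ : ℝ) : 𝕂)‖ := fun t => by
    simp only [hn]
    exact summable_of_sum_le (fun n => by positivity) fun F => sum_norm_comp_single_le f F t
  refine ⟨LinearMap.mkContinuous
    { toFun := fun t => ∑' n, S.coord t n * ((‖f.comp (single hS X 𝕜 n)‖ : ℝ) : 𝕂)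
      map_add' := fun t s => by
        rw [← (hs t).of_norm.tsum_add (hs s).of_norm]
        simp [add_mul]
      map_smul' := fun c t => by
        rw [RingHom.id_apply, smul_eq_mul, ← tsum_mul_left]
        simp [mul_assoc] } ‖f‖ fun t => ?_, fun t => (hs t).of_norm.hasSum⟩
  refine (norm_tsum_le_tsum_norm (hs t)).trans ((hs t).tsum_le_of_sum_le fun F => ?_)
  simp only [hn]
  exact sum_norm_comp_single_le f F t

/-- This places the norm sequence of a tail in the subspace on which `IsShrinking` bounds
functionals. -/
lemma normSeq_mem_closure_span (N : ℕ) (z : ESum hS X) (hz : ∀ n < N, z.toSeq n = 0) :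
    z.normSeq ∈ (Submodule.span 𝕂 (S.unit '' Set.Ici N)).topologicalClosure := by
  refine mem_closure_of_tendsto (hS.tendsto z.normSeq) (.of_forall fun M => ?_)
  refine Submodule.sum_mem _ fun n _ => ?_
  rcases lt_or_ge n N with h | h
  · simp [coord_normSeq, hz n h]
  · exact Submodule.smul_mem _ _ (Submodule.subset_span ⟨n, h, rfl⟩)

/-- If the canonical basis of `E` is shrinking, then every functional on the `E`-sum has small
tails. -/
theorem exists_norm_apply_sub_trunc_le (hS' : S.IsShrinking) (f : StrongDual 𝕜 (ESum hS X)) {ε : ℝ}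
    (hε : 0 < ε) : ∃ N, ∀ z, ‖f (z - trunc hS X 𝕜 N z)‖ ≤ ε * ‖z‖ := by
  obtain ⟨g, hg⟩ := exists_dual_hasSum f
  obtain ⟨N, hN⟩ := ((hS' g).eventually_lt_const hε).exists
  refine ⟨N, fun z => ?_⟩
  set w := z - trunc hS X 𝕜 N z with hw
  have hw0 : ∀ n < N, w.toSeq n = 0 := fun n hn => by rw [hw, toSeq_sub_trunc, if_pos hn]
  -- Componentwise estimates bound `f` on the finite truncations of `w`; the limit transfers the
  -- bound to `w`.
  have h1 : ‖f w‖ ≤ ‖g w.normSeq‖ := by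
    have hre : HasSum (fun n => ‖w.toSeq n‖ * ‖f.comp (single hS X 𝕜 n)‖)
        (RCLike.re (g w.normSeq)) := by
      have := (hg w.normSeq).map (RCLike.re : 𝕂 →+ ℝ) RCLike.continuous_re
      convert this using 1
      funext n
      simp [coord_normSeq]
    refine le_of_tendsto ((f.continuous.tendsto w).comp (tendsto_trunc (𝕜 := 𝕜) w)).norm
      (.of_forall fun M => ?_)
    rw [Function.comp_apply, trunc_apply, map_sum]
    refine (norm_sum_le _ _).trans (le_trans ?_ (RCLike.re_le_norm _))
    refine (Finset.sum_le_sum fun n _ => ?_).trans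
      (sum_le_hasSum (Finset.range M) (fun n _ => by positivity) hre)
    rw [mul_comm]
    exact (f.comp (single hS X 𝕜 n)).le_opNorm _
  have h2 := (g.comp (Submodule.span 𝕂 (S.unit '' Set.Ici N)).topologicalClosure.subtypeL).le_opNorm
    ⟨w.normSeq, normSeq_mem_closure_span N w hw0⟩
  have h3 : ‖g w.normSeq‖ ≤ ε * ‖w‖ :=
    h2.trans (mul_le_mul_of_nonneg_right hN.le (norm_nonneg _))
  exact h1.trans (h3.trans (mul_le_mul_of_nonneg_left (norm_sub_trunc_le N z) hε.le))

/-! ### Induction over truncations and conclusion -/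

variable [∀ n, NormedSpace ℝ (X n)] [∀ n, IsScalarTower ℝ 𝕜 (X n)]

lemma sliceDetermined_trunc (hX : ∀ n, IsSCDSpace 𝕜 (X n)) (N : ℕ) (A : Set (ESum hS X))
    (hA : Convex ℝ A) (hAb : Bornology.IsBounded A) : SliceDetermined A (trunc hS X 𝕜 N) := by
  have := separableSpace 𝕜 (hS := hS) fun n => (hX n).separable
  induction N generalizing A with
  | zero =>
    -- The truncation is zero here; the slice of the zero functional is `A` itself and only forces
    -- `B` to be nonempty.
    refine ⟨{(0, 1)}, Set.countable_singleton _, by simp, fun B hB hBS a ha ε hε => ?_⟩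
    obtain ⟨b, hb, -⟩ := hBS _ rfl
    exact ⟨b, subset_convexHull ℝ B hb, by simpa [trunc] using hε⟩
  | succ N ih =>
    -- `trunc (N + 1)` factors through the pair of `trunc N` and the coordinate `N`.
    have h := (SliceDetermined.prod ih (hX N).isSCDSet (proj hS X 𝕜 N) hA hAb).comp
      ((ContinuousLinearMap.id 𝕜 (ESum hS X)).coprod (single hS X 𝕜 N))
    convert h using 1
    ext x
    simp [trunc, Finset.sum_range_succ]

end ESum

theorem mainTheorem9 {𝕜 𝕂 : Type*} [RCLike 𝕜] [RCLike 𝕂]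
    {X : ℕ → Type*} [∀ n, NormedAddCommGroup (X n)] [∀ n, NormedSpace 𝕜 (X n)]
    [∀ n, NormedSpace ℝ (X n)] [∀ n, IsScalarTower ℝ 𝕜 (X n)]
    {E : Type*} [NormedAddCommGroup E] [NormedSpace 𝕂 E] [CompleteSpace E]
    (S : SequenceSpace 𝕂 E) (hS : S.IsOneUnconditional) (hS' : S.IsShrinking)
    (hX : ∀ n, IsSCDSpace 𝕜 (X n)) :
    IsSCDSpace 𝕜 (ESum hS X) := by
  refine ⟨ESum.completeSpace fun n => (hX n).complete,
    ESum.separableSpace 𝕜 fun n => (hX n).separable, fun A hA hAb => ?_⟩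
  choose 𝒮 h𝒮c h𝒮p h𝒮 using fun N => ESum.sliceDetermined_trunc hX N A hA hAb
  -- The added pair makes the countable family nonempty, so that a sequence enumerates it.
  obtain ⟨p, hp⟩ := ((Set.countable_iUnion h𝒮c).insert
    ((0, 1) : StrongDual 𝕜 (ESum hS X) × ℝ)).exists_eq_range (Set.insert_nonempty _ _)
  have hpos : ∀ n, 0 < (p n).2 := fun n => by
    have : p n ∈ insert (0, 1) (⋃ N, 𝒮 N) := hp ▸ Set.mem_range_self n
    rcases this with h | h
    · simp [h]
    · obtain ⟨N, hN⟩ := Set.mem_iUnion.1 h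
      exact h𝒮p N _ hN
  refine ⟨fun n => (p n).1, fun n => (p n).2, hpos, fun n => Set.sep_subset _ _,
    fun B hBA hB a ha => ?_⟩
  have hB' : ∀ N, ∀ q ∈ 𝒮 N, (B ∩ slice 𝕜 A q.1 q.2).Nonempty := fun N q hq => by
    have : q ∈ Set.range p := hp ▸ Set.mem_insert_of_mem _ (Set.mem_iUnion.2 ⟨N, hq⟩)
    obtain ⟨n, rfl⟩ := this
    exact hB n
  by_contra hcl
  obtain ⟨f, u, hfa, hfB⟩ := RCLike.geometric_hahn_banach_point_closed (𝕜 := 𝕜)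
    (convex_convexHull ℝ B).closure isClosed_closure hcl
  obtain ⟨C, hC0, hC⟩ := hAb.exists_pos_norm_le
  set η := u - RCLike.re (f a) with hη
  have hη0 : 0 < η := by linarith
  -- Since `‖b - a‖ ≤ 2 * C`, the tail contributes at most `η / 2` and the truncated part at most `η
  -- / 4`, less than the separation gap `η`.
  obtain ⟨N, hN⟩ := ESum.exists_norm_apply_sub_trunc_le hS' f (show 0 < η / (4 * C) by positivity)
  obtain ⟨b, hb, hba⟩ := h𝒮 N B hBA (hB' N) a ha (η / (4 * (‖f‖ + 1))) (by positivity)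
  have h1 := hfB b (subset_closure hb)
  have h2 : RCLike.re (f b) - RCLike.re (f a) ≤ ‖f (b - a)‖ := by
    rw [← map_sub, ← map_sub]
    exact RCLike.re_le_norm _
  have h3 : ‖f (b - a)‖ ≤ ‖f (b - a - ESum.trunc hS X 𝕜 N (b - a))‖ +
      ‖f (ESum.trunc hS X 𝕜 N (b - a))‖ := by
    conv_lhs => rw [← sub_add_cancel (b - a) (ESum.trunc hS X 𝕜 N (b - a)), map_add]
    exact norm_add_le _ _
  have h4 : ‖b - a‖ ≤ 2 * C := by
    have := norm_sub_le b a
    linarith [hC b (convexHull_min hBA hA hb), hC a ha]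
  have h5 : ‖f (b - a - ESum.trunc hS X 𝕜 N (b - a))‖ ≤ η / 2 := by
    refine (hN _).trans ((mul_le_mul_of_nonneg_left h4 (by positivity)).trans (le_of_eq ?_))
    field_simp
    ring
  have h6 : ‖f (ESum.trunc hS X 𝕜 N (b - a))‖ ≤ η / 4 := by
    rw [← map_sub] at hba
    refine (f.le_opNorm_of_le hba.le).trans ?_
    rw [← mul_div_assoc, div_le_div_iff₀ (by positivity) (by norm_num)]
    nlinarith
  linarith
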